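/- Let $f:\mathbb{R}^n\times\mathbb{R}^m\to\mathbb{R}^n$ be $C^1$, let $\Omega\subseteq\mathbb{R}^m$ be compact, let $T\ge 0$ and $\chi_i,\chi_f\in\mathbb{R}^n$. For $g\in\{f,-f\}$, a control on $[a,b]$ is a Lebesgue measurable function $u$ on $[a,b]$ with values in $\Omega$, and its response for $g$ from $x_0$ is a function $\chi$ on $[a,b]$ for which $s\mapsto g(\chi(s),u(s))$ is integrable and $\chi(t)=x_0+\int_a^t g(\chi(s),u(s))\,ds$ for all $t\in[a,b]$. Let $\mathbb{X}_1$ (resp. $\mathbb{X}_2$) be the set of all responses on $[0,T]$ for $f$ from $\chi_i$ (resp. for $-f$ from $\chi_f$), over all controls on $[0,T]$, and put $\mathcal{G}(f,t,\chi_i)=\{\chi(t):\chi\in\mathbb{X}_1\}$ and $\mathcal{G}(-f,t,\chi_f)=\{\chi(t):\chi\in\mathbb{X}_2\}$ for $t\in[0,T]$. The en route reachable tube is $$\mathcal{B}=\bigcup\{\chi([0,T]) : \chi\in\mathbb{X}_1,\ \chi(T)=\chi_f\}.$$ Assume that there is an $M$ with $|\chi(t)|<M$ for all $\chi\in\mathbb{X}_1$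 and $t\in[0,T]$, and that $\{f(x,u):u\in\Omega\}$ is convex for every $x\in\mathbb{R}^n$. Let $A_1,A_2$ be maps from $[0,T]$ to the nonempty compact subsets of $\mathbb{R}^n$ that are continuous in the Hausdorff metric, and suppose that the following hold. - For all $t\in[0,T]$, $\partial\mathcal{G}(f,t,\chi_i)\subseteq A_1(t)\subseteq\mathcal{G}(f,t,\chi_i)$ and $\partial\mathcal{G}(-f,T-t,\chi_f)\subseteq A_2(t)\subseteq\mathcal{G}(-f,T-t,\chi_f)$. - If $\chi_1\in\mathbb{X}_1$, $t'\in[0,T]$ and $\chi_1(t')\in A_1(t')$, then some control on $[t',T]$ has a response $\xi$ for $f$ from $\chi_1(t')$ on $[t',T]$ with $\xi(t)\in A_1(t)$ for all $t\in[t',T]$. If $\chi_2\in\mathbb{X}_2$, $t'\in[0,T]$ and $\chi_2(t')\in A_2(T-t')$, then some control on $[t',T]$ has a response $\xi$ for $-f$ from $\chi_2(t')$ on $[t',T]$ with $\xi(t)\in A_2(T-t)$ for all $t\in[t',T]$. Then for every $x\in\mathcal{B}$ there exist $\tau\in[0,T]$, $\chi_1\in\mathbb{X}_1$ and $\chi_2\in\mathbb{X}_2$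 such that 1. $\chi_1(\tau)=\chi_2(T-\tau)\in A_1(\tau)\cap A_2(\tau)$; 2. $x\in\chi_1([0,\tau])$ or $x\in\chi_2([0,T-\tau])$. -/

import Mathlib

open MeasureTheory Set

namespace Steering

/-- The Euclidean space `ℝⁿ`. -/
abbrev E (n : ℕ) : Type := EuclideanSpace ℝ (Fin n)

/-- `u` is a (Lebesgue) measurable control on `[a, b]` with values in the restraint set `Ω`.
Values of `u` outside `[a, b]` are irrelevant. -/
def IsControl {m : ℕ} (Ω : Set (E m)) (a b : ℝ) (u : ℝ → E m) : Prop :=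
  AEMeasurable u (volume.restrict (Icc a b)) ∧ ∀ t ∈ Icc a b, u t ∈ Ω

/-- `χ` is the response on `[a, b]`, starting at `x₀` at time `a`, of the dynamics
`χ' = f (χ, u)` to the control `u`, that is, the integral equation
`χ t = x₀ + ∫ s in a..t, f (χ s) (u s)` holds on `[a, b]` with an integrable integrand
(so `χ` is absolutely continuous there). Values of `χ` outside `[a, b]` are irrelevant. -/
def IsResponse {n m : ℕ} (f : E n → E m → E n) (a b : ℝ) (x₀ : E n)
    (u : ℝ → E m) (χ : ℝ → E n) : Prop :=
  IntegrableOn (fun s => f (χ s) (u s)) (Icc a b) ∧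
    ∀ t ∈ Icc a b, χ t = x₀ + ∫ s in a..t, f (χ s) (u s)

/-- All trajectories on `[0, T]` of the dynamics `f` starting at `x₀`, over all measurable
`Ω`-valued controls on `[0, T]`. -/
def trajectories {n m : ℕ} (f : E n → E m → E n) (Ω : Set (E m)) (T : ℝ) (x₀ : E n) :
    Set (ℝ → E n) :=
  {χ | ∃ u : ℝ → E m, IsControl Ω 0 T u ∧ IsResponse f 0 T x₀ u χ}

/-- The reachable set at time `t ∈ [0, T]`: the values at time `t` of the trajectories on
`[0, T]` of `f` starting at `x₀`. -/
def reachableSet {n m : ℕ} (f : E n → E m → E n) (Ω : Set (E m)) (T t : ℝ) (x₀ : E n) :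
    Set (E n) :=
  {x | ∃ χ ∈ trajectories f Ω T x₀, χ t = x}

/-- The state solutions of the point-to-point steering problem: trajectories on `[0, T]`
with `χ 0 = xi` and `χ T = xf`. -/
def steeringSolutions {n m : ℕ} (f : E n → E m → E n) (Ω : Set (E m)) (T : ℝ) (xi xf : E n) :
    Set (ℝ → E n) :=
  {χ | χ ∈ trajectories f Ω T xi ∧ χ T = xf}

/-- The en route reachable tube: all points through which the solutions of the steering problem
pass. -/
def enRouteTube {n m : ℕ} (f : E n → E m → E n) (Ω : Set (E m)) (T : ℝ) (xi xf : E n) :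
    Set (E n) :=
  ⋃ χ ∈ steeringSolutions f Ω T xi xf, χ '' Icc 0 T

end Steering

open Steering

/-!
Write `G₁ t` for the set reachable from `xi` at time `t` under `f`, and `G₂ t` for the set
reachable from `xf` under `-f` after the time `T - t`. A point of `A₁ τ ∩ A₂ τ` lies on a trajectory
of either kind, so it suffices to find a forward trajectory through `x` that later meets
`A₁ ∩ A₂`, or a backward trajectory through `x` that does so.

The main tool is an exit principle (`IsTube.mem_of_frequently_notMem`): if a continuous path is in
`Gᵢ s` at time `s` but outside of `Gᵢ t` at times `t` arbitrarily close to `s`, then it is in `Aᵢ s`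
at time `s`. Indeed `Gᵢ t` contains points near the path, because the trajectory through the
position at time `s` is continuous; it also misses points near the path, so it has boundary points
there, which are in `Aᵢ t` and accumulate in `Aᵢ s` by continuity of `Aᵢ`. Moreover the times which
a continuous path spends in `Gᵢ` form a closed set, since `Gᵢ t` is closed (it contains its
boundary) and since responses have locally bounded speed.

Let `x` lie on a solution of the steering problem, so that `x ∈ G₁ t ∩ G₂ t` for some `t`. At the
first such time `s`, the exit principle for the constant path `x` gives `x ∈ A₁ s` or `x ∈ A₂ s`
(if `s = 0`, then `G₁ 0 = {xi} = A₁ 0`). In the first case a trajectory through `x` continues within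
`A₁` up to time `T`. It starts in `G₂`, and either ends in `G₂ T = {xf} = A₂ T` or leaves `G₂`, and
at the last time in `G₂` it is in `A₂` by the exit principle. The second case is the first one after
reflection of time.
-/

namespace Steering

variable {n m : ℕ} {f : E n → E m → E n} {Ω : Set (E m)} {T : ℝ}

/-! ### Responses: continuity, local speed bound, reversal, concatenation -/

lemma IsResponse.intervalIntegrable {a b : ℝ} {x₀ : E n} {u : ℝ → E m} {χ : ℝ → E n}
    (h : IsResponse f a b x₀ u χ) {s t : ℝ} (hs : s ∈ Icc a b) (ht : t ∈ Icc a b) :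
    IntervalIntegrable (fun r => f (χ r) (u r)) volume s t := by
  rw [intervalIntegrable_iff]
  exact h.1.mono_set (uIoc_subset_uIcc.trans (uIcc_subset_Icc hs ht))

lemma IsResponse.sub_eq {a b : ℝ} {x₀ : E n} {u : ℝ → E m} {χ : ℝ → E n}
    (h : IsResponse f a b x₀ u χ) {s t : ℝ} (hs : s ∈ Icc a b) (ht : t ∈ Icc a b) :
    χ t - χ s = ∫ r in s..t, f (χ r) (u r) := by
  have ha : a ∈ Icc a b := ⟨le_rfl, hs.1.trans hs.2⟩
  rw [h.2 t ht, h.2 s hs, add_sub_add_left_eq_sub,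
    intervalIntegral.integral_interval_sub_left (h.intervalIntegrable ha ht)
      (h.intervalIntegrable ha hs)]

lemma IsResponse.continuousOn {a b : ℝ} {x₀ : E n} {u : ℝ → E m} {χ : ℝ → E n}
    (h : IsResponse f a b x₀ u χ) : ContinuousOn χ (Icc a b) := by
  rcases le_or_gt a b with hab | hab
  · have hc := intervalIntegral.continuousOn_primitive_interval
      (f := fun r => f (χ r) (u r)) (μ := volume) (a := a) (b := b) (by rw [uIcc_of_le hab]; exact h.1)
    rw [uIcc_of_le hab] at hc
    exact (continuousOn_const.add hc).congr h.2
  · simp [Icc_eq_empty hab.not_ge]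

/-- A response whose speed is at most `C` as long as it stays in the open `ρ`-ball around its
value at time `s` cannot leave that ball before the time `ρ / C` has elapsed, in either direction
of time. -/
lemma IsResponse.norm_sub_lt {a b : ℝ} {x₀ : E n} {u : ℝ → E m} {χ : ℝ → E n}
    (hu : IsControl Ω a b u) (h : IsResponse f a b x₀ u χ) {s t C ρ : ℝ}
    (hs : s ∈ Icc a b) (ht : t ∈ Icc a b)
    (hC : ∀ x, ‖x - χ s‖ < ρ → ∀ w ∈ Ω, ‖f x w‖ ≤ C) (hC0 : 0 ≤ C) (hρ : C * |t - s| < ρ) :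
    ‖χ t - χ s‖ < ρ := by
  by_contra! hcon
  -- Times between `s` and `t`, in either order, are written `s + σ * (t - s)` with `σ ∈ [0, 1]`.
  have hmem : ∀ σ ∈ Icc (0 : ℝ) 1, s + σ * (t - s) ∈ Icc a b := fun σ hσ => by
    have := (convex_Icc a b) hs ht (sub_nonneg.2 hσ.2) hσ.1 (by ring)
    simp only [smul_eq_mul] at this
    convert this using 1
    ring
  have hg : ContinuousOn (fun σ : ℝ => ‖χ (s + σ * (t - s)) - χ s‖) (Icc 0 1) :=
    ((h.continuousOn.comp (by fun_prop) hmem).sub continuousOn_const).norm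
  have hK : IsCompact {σ ∈ Icc (0 : ℝ) 1 | ρ ≤ ‖χ (s + σ * (t - s)) - χ s‖} :=
    isCompact_Icc.of_isClosed_subset (isClosed_Icc.isClosed_le continuousOn_const hg)
      (sep_subset _ _)
  obtain ⟨σ₀, ⟨hσ₀, hge⟩, hmin⟩ := hK.exists_isLeast ⟨1, ⟨by simp, by simpa using hcon⟩⟩
  refine hge.not_gt (lt_of_le_of_lt ?_ hρ)
  rw [h.sub_eq hs (hmem σ₀ hσ₀)]
  have hle : C * |s + σ₀ * (t - s) - s| ≤ C * |t - s| := by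
    refine mul_le_mul_of_nonneg_left ?_ hC0
    rw [add_sub_cancel_left, abs_mul, abs_of_nonneg hσ₀.1]
    exact mul_le_of_le_one_left (abs_nonneg _) hσ₀.2
  refine (intervalIntegral.norm_integral_le_of_norm_le_const_ae ?_).trans hle
  -- At the exit time itself the speed bound may fail; a single time is negligible.
  filter_upwards [compl_mem_ae_iff.2 (measure_singleton (s + σ₀ * (t - s)))] with w hw hwI
  obtain ⟨σ, hσ, rfl⟩ : ∃ σ ∈ Icc 0 σ₀, s + σ * (t - s) = w := by
    have hw' := uIoc_subset_uIcc hwI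
    rw [← segment_eq_uIcc, segment_eq_image'] at hw'
    obtain ⟨θ, hθ, rfl⟩ := hw'
    refine ⟨θ * σ₀, ⟨mul_nonneg hθ.1 hσ₀.1, mul_le_of_le_one_left hσ₀.1 hθ.2⟩, ?_⟩
    simp only [smul_eq_mul]
    ring
  have hσ1 : σ ∈ Icc (0 : ℝ) 1 := ⟨hσ.1, hσ.2.trans hσ₀.2⟩
  refine hC _ ?_ _ (hu.2 _ (hmem σ hσ1))
  by_contra! hbig
  exact hw (by rw [le_antisymm hσ.2 (hmin ⟨hσ1, hbig⟩)]; rfl)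

lemma continuousOn_of_mem_trajectories {x₀ : E n} {χ : ℝ → E n}
    (h : χ ∈ trajectories f Ω T x₀) : ContinuousOn χ (Icc 0 T) := by
  obtain ⟨u, -, hr⟩ := h
  exact hr.continuousOn

/-- Running a trajectory of `f` backwards from its end point gives a trajectory of `-f`. -/
lemma reverse_mem_trajectories {x₀ : E n} {χ : ℝ → E n} (hT : 0 ≤ T)
    (h : χ ∈ trajectories f Ω T x₀) :
    (fun t => χ (T - t)) ∈ trajectories (-f) Ω T (χ T) := by
  obtain ⟨u, hu, hr⟩ := h
  have hrefl : ∀ t ∈ Icc 0 T, T - t ∈ Icc 0 T := fun t ht => ⟨by linarith [ht.2], by linarith [ht.1]⟩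
  have hpre : (fun t => T - t) ⁻¹' Icc 0 T = Icc 0 T := by
    rw [preimage_const_sub_Icc]; simp
  have hmp : MeasurePreserving (fun t : ℝ => T - t) (volume.restrict (Icc 0 T))
      (volume.restrict (Icc 0 T)) := by
    have := (Measure.measurePreserving_sub_left (volume : Measure ℝ) T).restrict_preimage
      (measurableSet_Icc (a := (0 : ℝ)) (b := T))
    rwa [hpre] at this
  refine ⟨fun t => u (T - t), ⟨hu.1.comp_quasiMeasurePreserving hmp.quasiMeasurePreserving,
    fun t ht => hu.2 _ (hrefl t ht)⟩, ?_, fun t ht => ?_⟩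
  · exact (hmp.integrable_comp_of_integrable hr.1).neg
  · have h1 := hr.sub_eq (hrefl t ht) (right_mem_Icc.2 hT)
    have h2 : (∫ s in (0 : ℝ)..t, (-f) (χ (T - s)) (u (T - s)))
        = -∫ r in (T - t)..T, f (χ r) (u r) := by
      have := intervalIntegral.integral_comp_sub_left (a := 0) (b := t)
        (fun r => f (χ r) (u r)) T
      simp only [sub_zero] at this
      simp only [Pi.neg_apply, intervalIntegral.integral_neg, this]
    simp only [h2, ← h1]
    abel

/-- A trajectory may be continued from any time `t'` by a response on `[t', T]`. -/
lemma concat_mem_trajectories {x₀ : E n} {χ ξ : ℝ → E n} {v : ℝ → E m} {t' : ℝ}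
    (h : χ ∈ trajectories f Ω T x₀) (ht' : t' ∈ Icc 0 T) (hv : IsControl Ω t' T v)
    (hξ : IsResponse f t' T (χ t') v ξ) :
    (fun t => if t < t' then χ t else ξ t) ∈ trajectories f Ω T x₀ := by
  classical
  obtain ⟨u, hu, hr⟩ := h
  have hξt' : ξ t' = χ t' := by simpa using hξ.2 t' (left_mem_Icc.2 ht'.2)
  set F : ℝ → E n := fun s => f (if s < t' then χ s else ξ s) (if s < t' then u s else v s) with hF
  have hF₁ : ∀ s, s < t' → F s = f (χ s) (u s) := fun s hs => by simp [hF, hs]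
  have hF₂ : ∀ s, t' ≤ s → F s = f (ξ s) (v s) := fun s hs => by simp [hF, hs.not_gt]
  have hunion : Icc 0 T = Ico 0 t' ∪ Icc t' T := (Ico_union_Icc_eq_Icc ht'.1 ht'.2).symm
  have hsub₁ : Ico 0 t' ⊆ Icc 0 T := fun s hs => ⟨hs.1, hs.2.le.trans ht'.2⟩
  have hint : IntegrableOn F (Icc 0 T) := by
    rw [hunion]
    exact ((hr.1.mono_set hsub₁).congr_fun (fun s hs => (hF₁ s hs.2).symm) measurableSet_Ico).union
      (hξ.1.congr_fun (fun s hs => (hF₂ s hs.1).symm) measurableSet_Icc)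
  have hii : ∀ s ∈ Icc 0 T, ∀ t ∈ Icc 0 T, IntervalIntegrable F volume s t := fun s hs t ht => by
    rw [intervalIntegrable_iff]
    exact hint.mono_set (uIoc_subset_uIcc.trans (uIcc_subset_Icc hs ht))
  have h0 : (0 : ℝ) ∈ Icc 0 T := ⟨le_rfl, ht'.1.trans ht'.2⟩
  have hleft : ∀ t ∈ Icc 0 t', ∫ s in (0 : ℝ)..t, F s = ∫ s in (0 : ℝ)..t, f (χ s) (u s) := by
    intro t ht
    refine intervalIntegral.integral_congr_ae ?_
    filter_upwards [compl_mem_ae_iff.2 (measure_singleton t')] with s hs hsI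
    rw [uIoc_of_le ht.1] at hsI
    exact hF₁ s (lt_of_le_of_ne (hsI.2.trans ht.2) hs)
  refine ⟨fun s => if s < t' then u s else v s, ⟨?_, fun t ht => ?_⟩, hint, fun t ht => ?_⟩
  · rw [hunion, aemeasurable_union_iff]
    constructor
    · refine (hu.1.mono_measure (Measure.restrict_mono hsub₁ le_rfl)).congr ?_
      filter_upwards [ae_restrict_mem measurableSet_Ico] with s hs
      simp [hs.2]
    · refine hv.1.congr ?_
      filter_upwards [ae_restrict_mem measurableSet_Icc] with s hs
      simp [hs.1.not_gt]
  · by_cases htt : t < t'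
    · simpa [htt] using hu.2 t ht
    · simpa [htt] using hv.2 t ⟨not_lt.1 htt, ht.2⟩
  · change _ = x₀ + ∫ s in (0 : ℝ)..t, F s
    by_cases htt : t < t'
    · simp only [htt, if_true]
      rw [hleft t ⟨ht.1, htt.le⟩]
      exact hr.2 t ht
    · have hle := not_lt.1 htt
      simp only [htt, if_false]
      have hright : ∫ s in t'..t, F s = ∫ s in t'..t, f (ξ s) (v s) :=
        intervalIntegral.integral_congr fun s hs => by
          rw [uIcc_of_le hle] at hs
          exact hF₂ s hs.1
      rw [← intervalIntegral.integral_add_adjacent_intervals (hii 0 h0 t' ht') (hii t' ht' t ht),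
        hleft t' ⟨ht'.1, le_rfl⟩, hright, ← add_assoc, ← hr.2 t' ht']
      exact hξ.2 t ⟨hle, ht.2⟩

/-! ### Tubes and their sandwiched subsets -/

/-- A time-dependent family of sets `G t`, `t ∈ [0, T]`, such that every point of `G s` lies on a
continuous path that stays in the family during all of `[0, T]`, and such that a point of `G s`
close to `y` can be moved to a point of `G t` close to `y` when `t` is close to `s`, locally
uniformly. The reachable sets of a control system form such a family. -/
structure IsTube (T : ℝ) (G : ℝ → Set (E n)) : Prop where
  exists_path : ∀ s ∈ Icc 0 T, ∀ y ∈ G s,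
    ∃ η : ℝ → E n, ContinuousOn η (Icc 0 T) ∧ η s = y ∧ ∀ t ∈ Icc 0 T, η t ∈ G t
  exists_near : ∀ y : E n, ∀ ε > 0, ∃ δ > 0, ∀ s ∈ Icc 0 T, ∀ t ∈ Icc 0 T, |t - s| < δ →
    ∀ z ∈ G s, dist z y < δ → ∃ w ∈ G t, dist w y < ε

/-- `A` is a continuous compact-valued selection from the sets `G t` that contains their
boundaries. -/
structure IsSandwiched (T : ℝ) (G : ℝ → Set (E n))
    (A : ℝ → TopologicalSpace.NonemptyCompacts (E n)) : Prop where
  continuousOn : ContinuousOn A (Icc 0 T)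
  frontier_subset : ∀ t ∈ Icc 0 T, frontier (G t) ⊆ A t
  subset : ∀ t ∈ Icc 0 T, (A t : Set (E n)) ⊆ G t

lemma sub_mem_Icc_zero {t : ℝ} (ht : t ∈ Icc 0 T) : T - t ∈ Icc 0 T :=
  ⟨sub_nonneg.2 ht.2, sub_le_self _ ht.1⟩

lemma continuousOn_reflect {X : Type*} [TopologicalSpace X] {g : ℝ → X}
    (hg : ContinuousOn g (Icc 0 T)) : ContinuousOn (fun t => g (T - t)) (Icc 0 T) :=
  hg.comp (by fun_prop) fun _ => sub_mem_Icc_zero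

lemma IsTube.reflect {G : ℝ → Set (E n)} (hG : IsTube T G) : IsTube T (fun t => G (T - t)) where
  exists_path s hs y hy := by
    obtain ⟨η, hc, hη, hmem⟩ := hG.exists_path _ (sub_mem_Icc_zero hs) y hy
    exact ⟨fun t => η (T - t), continuousOn_reflect hc, hη,
      fun t ht => hmem _ (sub_mem_Icc_zero ht)⟩
  exists_near y ε hε := by
    obtain ⟨δ, hδ, h⟩ := hG.exists_near y ε hε
    refine ⟨δ, hδ, fun s hs t ht hst =>
      h _ (sub_mem_Icc_zero hs) _ (sub_mem_Icc_zero ht) ?_⟩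
    rwa [sub_sub_sub_cancel_left, abs_sub_comm]

lemma IsSandwiched.reflect {G : ℝ → Set (E n)} {A : ℝ → TopologicalSpace.NonemptyCompacts (E n)}
    (h : IsSandwiched T G A) : IsSandwiched T (fun t => G (T - t)) (fun t => A (T - t)) where
  continuousOn := continuousOn_reflect h.continuousOn
  frontier_subset _ ht := h.frontier_subset _ (sub_mem_Icc_zero ht)
  subset _ ht := h.subset _ (sub_mem_Icc_zero ht)

lemma isTube_reachableSet (hf : Continuous fun p : E n × E m => f p.1 p.2) (hΩ : IsCompact Ω)
    (x₀ : E n) : IsTube T (fun t => reachableSet f Ω T t x₀) where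
  exists_path := by
    rintro s hs y ⟨χ, hχ, rfl⟩
    exact ⟨χ, continuousOn_of_mem_trajectories hχ, rfl, fun t _ => ⟨χ, hχ, rfl⟩⟩
  exists_near y ε hε := by
    obtain ⟨C, hC⟩ := ((isCompact_closedBall y ε).prod hΩ).exists_bound_of_continuousOn
      hf.continuousOn
    set D := max C 1 with hD
    have hD0 : 0 < D := lt_max_of_lt_right one_pos
    refine ⟨min (ε / 2) (ε / 2 / D), by positivity, ?_⟩
    rintro s hs t ht hst z ⟨χ, ⟨u, hu, hr⟩, rfl⟩ hz
    refine ⟨χ t, ⟨χ, ⟨u, hu, hr⟩, rfl⟩, ?_⟩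
    have hz' := hz.trans_le (min_le_left _ _)
    have hst' : D * |t - s| < ε / 2 := by
      rw [mul_comm]
      exact (lt_div_iff₀ hD0).1 (hst.trans_le (min_le_right _ _))
    have key : dist (χ t) (χ s) < ε / 2 := by
      rw [dist_eq_norm]
      refine hr.norm_sub_lt hu hs ht (fun x hx w hw => ?_) hD0.le hst'
      rw [← dist_eq_norm] at hx
      refine (hC (x, w) ⟨?_, hw⟩).trans (le_max_left _ _)
      rw [Metric.mem_closedBall]
      linarith [dist_triangle x (χ s) y]
    linarith [dist_triangle (χ t) (χ s) y]

/-- The times at which a continuous path lies in a sandwiched tube form a closed set. -/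
lemma IsTube.isClosed_setOf_mem {G : ℝ → Set (E n)}
    {A : ℝ → TopologicalSpace.NonemptyCompacts (E n)} (hG : IsTube T G)
    (hA : IsSandwiched T G A) {ψ : ℝ → E n} (hψ : ContinuousOn ψ (Icc 0 T)) :
    IsClosed {t ∈ Icc 0 T | ψ t ∈ G t} := by
  refine isClosed_of_closure_subset fun t ht => ?_
  have htI : t ∈ Icc 0 T := closure_minimal (sep_subset _ _) isClosed_Icc ht
  refine ⟨htI, ?_⟩
  have hcl : closure (G t) ⊆ G t := by
    rw [closure_eq_self_union_frontier]
    exact union_subset subset_rfl ((hA.frontier_subset t htI).trans (hA.subset t htI))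
  refine hcl (Metric.mem_closure_iff.2 fun ε hε => ?_)
  obtain ⟨δ, hδ, h⟩ := hG.exists_near (ψ t) ε hε
  obtain ⟨δ', hδ', h'⟩ := Metric.continuousOn_iff.1 hψ t htI δ hδ
  obtain ⟨s, ⟨hs, hsG⟩, hts⟩ := Metric.mem_closure_iff.1 ht (min δ δ') (lt_min hδ hδ')
  obtain ⟨w, hw, hwt⟩ := h s hs t htI (hts.trans_le (min_le_left _ _)) _ hsG
    (h' s hs (by rw [dist_comm]; exact hts.trans_le (min_le_right _ _)))
  exact ⟨w, hw, by rwa [dist_comm]⟩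

lemma inter_frontier_nonempty_of_isPreconnected {X : Type*} [TopologicalSpace X] {U S : Set X}
    (hU : IsPreconnected U) (hS : (U ∩ S).Nonempty) (hS' : (U ∩ Sᶜ).Nonempty) :
    (U ∩ frontier S).Nonempty := by
  by_contra hcon
  have hsub : U ⊆ interior S ∪ interior Sᶜ := by
    rw [← compl_frontier_eq_union_interior]
    exact fun y hy hyf => hcon ⟨y, hy, hyf⟩
  obtain ⟨a, haU, haS⟩ := hS
  obtain ⟨b, hbU, hbS⟩ := hS'
  obtain ⟨y, -, hy₁, hy₂⟩ := hU _ _ isOpen_interior isOpen_interior hsub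
    ⟨a, haU, (hsub haU).resolve_right fun h => interior_subset h haS⟩
    ⟨b, hbU, (hsub hbU).resolve_left fun h => hbS (interior_subset h)⟩
  exact interior_subset hy₂ (interior_subset hy₁)

/-- A continuous path that lies in `G s` at time `s` and outside of `G t` at times `t` arbitrarily
close to `s` lies in `A s` at time `s`: near the path, `G t` has both points and non-points, hence
boundary points, which belong to `A t`, and these accumulate in `A s`. -/
lemma IsTube.mem_of_frequently_notMem {G : ℝ → Set (E n)}
    {A : ℝ → TopologicalSpace.NonemptyCompacts (E n)} (hG : IsTube T G)
    (hA : IsSandwiched T G A) {ψ : ℝ → E n} (hψ : ContinuousOn ψ (Icc 0 T)) {s : ℝ}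
    (hs : s ∈ Icc 0 T) (hsG : ψ s ∈ G s)
    (hexit : ∃ᶠ t in nhdsWithin s (Icc 0 T), ψ t ∉ G t) : ψ s ∈ A s := by
  obtain ⟨η, hη, hηs, hηG⟩ := hG.exists_path s hs _ hsG
  have hcl : IsClosed (A s : Set (E n)) := (A s).isCompact.isClosed
  rw [← SetLike.mem_coe, ← hcl.closure_eq]
  refine Metric.mem_closure_iff.2 fun ε hε => ?_
  have h1 := Metric.continuousWithinAt_iff'.1 (hψ s hs) (ε / 2) (by positivity)
  have h2 := Metric.continuousWithinAt_iff'.1 (hη s hs) (ε / 2) (by positivity)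
  have h3 := Metric.continuousWithinAt_iff'.1 (hA.continuousOn s hs) (ε / 2) (by positivity)
  obtain ⟨t, htG, h1, h2, h3, htI⟩ :=
    (hexit.and_eventually (h1.and (h2.and (h3.and self_mem_nhdsWithin)))).exists
  rw [hηs] at h2
  obtain ⟨p, hp, hpf⟩ := inter_frontier_nonempty_of_isPreconnected
    (convex_ball (ψ s) (ε / 2)).isPreconnected ⟨η t, h2, hηG t htI⟩ ⟨ψ t, h1, htG⟩
  rw [Metric.NonemptyCompacts.dist_eq] at h3
  obtain ⟨q, hq, hpq⟩ := Metric.exists_dist_lt_of_hausdorffDist_lt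
    (hA.frontier_subset t htI hpf) h3 (Metric.hausdorffEDist_ne_top_of_nonempty_of_bounded
      (A t).nonempty (A s).nonempty (A t).isCompact.isBounded (A s).isCompact.isBounded)
  refine ⟨q, hq, ?_⟩
  rw [Metric.mem_ball, dist_comm] at hp
  linarith [dist_triangle (ψ s) p q]

lemma eq_of_mem_reachableSet_zero {x₀ x : E n} (hT : 0 ≤ T)
    (hx : x ∈ reachableSet f Ω T 0 x₀) : x = x₀ := by
  obtain ⟨χ, ⟨u, -, hr⟩, rfl⟩ := hx
  simpa using hr.2 0 (left_mem_Icc.2 hT)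

/-- At time `0` the reachable set is at most a point, so the selection `A 0` fills it. -/
lemma IsSandwiched.mem_zero {x₀ x : E n} {A : ℝ → TopologicalSpace.NonemptyCompacts (E n)}
    (hT : 0 ≤ T) (hA : IsSandwiched T (fun t => reachableSet f Ω T t x₀) A)
    (hx : x ∈ reachableSet f Ω T 0 x₀) : x ∈ A 0 := by
  obtain ⟨y, hy⟩ := (A 0).nonempty
  have hyx : y = x₀ := eq_of_mem_reachableSet_zero hT (hA.subset 0 (left_mem_Icc.2 hT) hy)
  rw [eq_of_mem_reachableSet_zero hT hx, ← hyx]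
  exact hy

/-! ### Trajectories inside one selection hit the other -/

/-- A point `x` of `A₁ t` from which `xf` can be reached lies on a trajectory that stays in `A₁`
after time `t`; this trajectory must leave the backward tube of `xf`, or end in `xf`, and thus
meets `A₂` at some time `τ ≥ t`. -/
lemma exists_trajectory_mem_inter
    (hΩ : IsCompact Ω) (hT : 0 ≤ T) {g : E n → E m → E n}
    (hg : Continuous fun p : E n × E m => g p.1 p.2) {xi xf : E n}
    {A₁ A₂ : ℝ → TopologicalSpace.NonemptyCompacts (E n)}
    (hA₁ : IsSandwiched T (fun t => reachableSet f Ω T t xi) A₁)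
    (hA₂ : IsSandwiched T (fun t => reachableSet g Ω T (T - t) xf) A₂)
    (hext : ∀ χ ∈ trajectories f Ω T xi, ∀ t' ∈ Icc 0 T, χ t' ∈ A₁ t' →
      ∃ (u : ℝ → E m) (ξ : ℝ → E n), IsControl Ω t' T u ∧ IsResponse f t' T (χ t') u ξ ∧
        ∀ t ∈ Icc t' T, ξ t ∈ A₁ t)
    {x : E n} {t : ℝ} (ht : t ∈ Icc 0 T) (hx₁ : x ∈ A₁ t)
    (hx₂ : x ∈ reachableSet g Ω T (T - t) xf) :
    ∃ τ ∈ Icc t T, ∃ χ ∈ trajectories f Ω T xi, χ t = x ∧ χ τ ∈ A₁ τ ∧ χ τ ∈ A₂ τ := by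
  obtain ⟨χ, hχ, rfl⟩ := hA₁.subset t ht hx₁
  obtain ⟨u, ξ, hu, hξ, hξA⟩ := hext χ hχ t ht hx₁
  have hψ := concat_mem_trajectories hχ ht hu hξ
  set ψ : ℝ → E n := fun r => if r < t then χ r else ξ r with hψdef
  have hψA : ∀ r ∈ Icc t T, ψ r ∈ A₁ r := fun r hr => by
    simpa [hψdef, hr.1.not_gt] using hξA r hr
  have hψt : ψ t = χ t := by simpa [hψdef] using hξ.2 t (left_mem_Icc.2 ht.2)
  have hψc := continuousOn_of_mem_trajectories hψ
  have hG₂ : IsTube T (fun t => reachableSet g Ω T (T - t) xf) :=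
    (isTube_reachableSet hg hΩ xf).reflect
  have hK : IsCompact {r ∈ Icc 0 T | ψ r ∈ reachableSet g Ω T (T - r) xf} :=
    isCompact_Icc.of_isClosed_subset (hG₂.isClosed_setOf_mem hA₂ hψc) (sep_subset _ _)
  obtain ⟨τ, ⟨hτ, hτG⟩, hmax⟩ := hK.exists_isGreatest ⟨t, ht, by rwa [hψt]⟩
  have htτ : t ≤ τ := hmax ⟨ht, by rwa [hψt]⟩
  refine ⟨τ, ⟨htτ, hτ.2⟩, ψ, hψ, hψt, hψA τ ⟨htτ, hτ.2⟩, ?_⟩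
  rcases hτ.2.eq_or_lt with rfl | hlt
  · have hz := hA₂.reflect
    simp only [sub_sub_cancel] at hz
    simpa using hz.mem_zero hT (x := ψ τ) (by simpa using hτG)
  · refine hG₂.mem_of_frequently_notMem hA₂ hψc hτ hτG ?_
    have hev : ∀ᶠ r in nhdsWithin τ (Ioc τ T), ψ r ∉ reachableSet g Ω T (T - r) xf :=
      eventually_mem_nhdsWithin.mono fun r hr hrG =>
        (hmax ⟨⟨hτ.1.trans hr.1.le, hr.2⟩, hrG⟩).not_gt hr.1
    have hne : (nhdsWithin τ (Ioc τ T)).NeBot := by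
      rw [nhdsWithin_Ioc_eq_nhdsGT hlt]
      infer_instance
    exact hev.frequently.filter_mono
      (nhdsWithin_mono _ fun r hr => ⟨hτ.1.trans hr.1.le, hr.2⟩)

/-- A point `x` common to both tubes at some time lies, at some possibly earlier time, in one of
the tubes and in the selection from the other: the first time at which `x` is common to both
tubes has this property. -/
lemma exists_mem_selection {G₁ G₂ : ℝ → Set (E n)}
    {A₁ A₂ : ℝ → TopologicalSpace.NonemptyCompacts (E n)}
    (hG₁ : IsTube T G₁) (hG₂ : IsTube T G₂)
    (hA₁ : IsSandwiched T G₁ A₁) (hA₂ : IsSandwiched T G₂ A₂)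
    {x : E n} (h0 : x ∈ G₁ 0 → x ∈ A₁ 0) {t : ℝ} (ht : t ∈ Icc 0 T) (hx₁ : x ∈ G₁ t)
    (hx₂ : x ∈ G₂ t) :
    ∃ s ∈ Icc 0 T, x ∈ A₁ s ∧ x ∈ G₂ s ∨ x ∈ G₁ s ∧ x ∈ A₂ s := by
  have hc : ContinuousOn (fun _ : ℝ => x) (Icc 0 T) := continuousOn_const
  have hK : IsCompact ({r ∈ Icc 0 T | x ∈ G₁ r} ∩ {r ∈ Icc 0 T | x ∈ G₂ r}) :=
    isCompact_Icc.of_isClosed_subset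
      ((hG₁.isClosed_setOf_mem hA₁ hc).inter (hG₂.isClosed_setOf_mem hA₂ hc))
      fun r hr => hr.1.1
  obtain ⟨s, ⟨⟨hs, hs₁⟩, -, hs₂⟩, hmin⟩ := hK.exists_isLeast ⟨t, ⟨ht, hx₁⟩, ht, hx₂⟩
  refine ⟨s, hs, ?_⟩
  rcases hs.1.eq_or_lt with rfl | hpos
  · exact Or.inl ⟨h0 hs₁, hs₂⟩
  have hev : ∀ᶠ r in nhdsWithin s (Ico 0 s), x ∉ G₁ r ∨ x ∉ G₂ r := by
    refine eventually_mem_nhdsWithin.mono fun r hr => ?_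
    by_contra! hcon
    have hrI : r ∈ Icc 0 T := ⟨hr.1, hr.2.le.trans hs.2⟩
    exact (hmin ⟨⟨hrI, hcon.1⟩, hrI, hcon.2⟩).not_gt hr.2
  have hne : (nhdsWithin s (Ico 0 s)).NeBot := by
    rw [nhdsWithin_Ico_eq_nhdsLT hpos]
    infer_instance
  have hfreq := hev.frequently.filter_mono
    (nhdsWithin_mono s fun r hr => (⟨hr.1, hr.2.le.trans hs.2⟩ : r ∈ Icc 0 T))
  rcases Filter.frequently_or_distrib.1 hfreq with h | h
  · exact Or.inl ⟨hG₁.mem_of_frequently_notMem hA₁ hc hs hs₁ h, hs₂⟩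
  · exact Or.inr ⟨hs₁, hG₂.mem_of_frequently_notMem hA₂ hc hs hs₂ h⟩

end Steering

theorem theorem2 {n m : ℕ} (f : E n → E m → E n)
    (hf : ContDiff ℝ 1 (fun p : E n × E m => f p.1 p.2))
    (Ω : Set (E m)) (hΩ : IsCompact Ω)
    (T : ℝ) (hT : 0 ≤ T) (xi xf : E n)
    -- uniform bound on the responses of the system, and convex velocity sets
    (hbound : ∃ M : ℝ, ∀ χ ∈ trajectories f Ω T xi, ∀ t ∈ Icc 0 T, ‖χ t‖ < M)
    (hconvex : ∀ x : E n, Convex ℝ (f x '' Ω))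
    -- nonempty, compact-valued maps, continuous for the Hausdorff metric
    (A₁ A₂ : ℝ → TopologicalSpace.NonemptyCompacts (E n))
    (hA₁ : ContinuousOn A₁ (Icc 0 T)) (hA₂ : ContinuousOn A₂ (Icc 0 T))
    (hsand₁ : ∀ t ∈ Icc 0 T, frontier (reachableSet f Ω T t xi) ⊆ (A₁ t : Set (E n)) ∧
      (A₁ t : Set (E n)) ⊆ reachableSet f Ω T t xi)
    (hsand₂ : ∀ t ∈ Icc 0 T, frontier (reachableSet (-f) Ω T (T - t) xf) ⊆ (A₂ t : Set (E n)) ∧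
      (A₂ t : Set (E n)) ⊆ reachableSet (-f) Ω T (T - t) xf)
    (hext₁ : ∀ χ₁ ∈ trajectories f Ω T xi, ∀ t' ∈ Icc 0 T, χ₁ t' ∈ A₁ t' →
      ∃ (u : ℝ → E m) (ξ : ℝ → E n), IsControl Ω t' T u ∧ IsResponse f t' T (χ₁ t') u ξ ∧
        ∀ t ∈ Icc t' T, ξ t ∈ A₁ t)
    (hext₂ : ∀ χ₂ ∈ trajectories (-f) Ω T xf, ∀ t' ∈ Icc 0 T, χ₂ t' ∈ A₂ (T - t') →
      ∃ (u : ℝ → E m) (ξ : ℝ → E n), IsControl Ω t' T u ∧ IsResponse (-f) t' T (χ₂ t') u ξ ∧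
        ∀ t ∈ Icc t' T, ξ t ∈ A₂ (T - t)) :
    ∀ x ∈ enRouteTube f Ω T xi xf,
      ∃ τ ∈ Icc 0 T, ∃ χ₁ ∈ trajectories f Ω T xi, ∃ χ₂ ∈ trajectories (-f) Ω T xf,
        χ₁ τ = χ₂ (T - τ) ∧ χ₁ τ ∈ (A₁ τ : Set (E n)) ∩ (A₂ τ : Set (E n)) ∧
        (x ∈ χ₁ '' Icc 0 τ ∨ x ∈ χ₂ '' Icc 0 (T - τ)) := by
  intro x hx
  simp only [enRouteTube, steeringSolutions, mem_iUnion, mem_ofPred_eq] at hx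
  obtain ⟨χ, ⟨hχ, rfl⟩, t, ht, rfl⟩ := hx
  have hfc : Continuous fun p : E n × E m => f p.1 p.2 := hf.continuous
  have hgc : Continuous fun p : E n × E m => (-f) p.1 p.2 := hfc.neg
  have hS₁ : IsSandwiched T (fun t => reachableSet f Ω T t xi) A₁ :=
    ⟨hA₁, fun t ht => (hsand₁ t ht).1, fun t ht => (hsand₁ t ht).2⟩
  have hS₂ : IsSandwiched T (fun t => reachableSet (-f) Ω T (T - t) (χ T)) A₂ :=
    ⟨hA₂, fun t ht => (hsand₂ t ht).1, fun t ht => (hsand₂ t ht).2⟩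
  obtain ⟨s, hs, ⟨hx₁, hx₂⟩ | ⟨hx₁, hx₂⟩⟩ := exists_mem_selection
    (isTube_reachableSet hfc hΩ xi) (isTube_reachableSet hgc hΩ (χ T)).reflect hS₁ hS₂
    (hS₁.mem_zero hT) ht ⟨χ, hχ, rfl⟩
    ⟨fun r => χ (T - r), reverse_mem_trajectories hT hχ, by simp⟩
  · obtain ⟨τ, hτ, χ₁, hχ₁, hχ₁s, hτ₁, hτ₂⟩ :=
      exists_trajectory_mem_inter hΩ hT hgc hS₁ hS₂ hext₁ hs hx₁ hx₂
    have hτI : τ ∈ Icc 0 T := ⟨hs.1.trans hτ.1, hτ.2⟩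
    obtain ⟨χ₂, hχ₂, h⟩ := hS₂.subset τ hτI hτ₂
    exact ⟨τ, hτI, χ₁, hχ₁, χ₂, hχ₂, h.symm, ⟨hτ₁, hτ₂⟩, Or.inl ⟨s, ⟨hs.1, hτ.1⟩, hχ₁s⟩⟩
  · -- Time reflection exchanges `f` with `-f` and the two selections.
    have hR₂ := hS₂.reflect
    simp only [sub_sub_cancel] at hR₂
    obtain ⟨τ, hτ, χ₂, hχ₂, hχ₂s, hτ₂, hτ₁⟩ :=
      exists_trajectory_mem_inter hΩ hT hfc hR₂ hS₁.reflect hext₂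
        (sub_mem_Icc_zero hs) (by rwa [sub_sub_cancel]) (by rwa [sub_sub_cancel])
    have hτI : τ ∈ Icc 0 T := ⟨(sub_mem_Icc_zero hs).1.trans hτ.1, hτ.2⟩
    have hτI' := sub_mem_Icc_zero hτI
    obtain ⟨χ₁, hχ₁, h⟩ := hS₁.subset _ hτI' hτ₁
    refine ⟨T - τ, hτI', χ₁, hχ₁, χ₂, hχ₂, by rw [sub_sub_cancel]; exact h, ?_, ?_⟩
    · rw [h]
      exact ⟨hτ₁, hτ₂⟩
    · rw [sub_sub_cancel]
      exact Or.inr ⟨T - s, ⟨(sub_mem_Icc_zero hs).1, hτ.1⟩, hχ₂s⟩
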